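/- Let $(V,|0\rangle,T,Y)$ consist of a complex superspace $V=V_{\bar 0}\oplus V_{\bar 1}$, an even vector $|0\rangle$, an even endomorphism $T$, and a linear parity-preserving map $a\mapsto Y(a,z)=\sum_{n\in\mathbb Z}a_{(n)}z^{-n-1}\in \mathrm{End}(V)[[z,z^{-1}]]$ such that $Y(a,z)v\in V[[z]][z^{-1}]$ for all $a,v\in V$ (call such a $Y$ a state-field correspondence). It is a vertex algebra if $Y(|0\rangle,z)=\mathrm{Id}_V$, $Y(a,z)|0\rangle\in a+zV[[z]]$, $T|0\rangle=0$, $[T,Y(a,z)]=\partial_zY(a,z)$, and for all $a,b\in V$, $(z-w)^N\big(Y(a,z)Y(b,w)-p(a,b)Y(b,w)Y(a,z)\big)=0$ for $N\gg0$. Here $p(a,b)=(-1)^{p(a)p(b)}$ for homogeneous $a,b$, and expressions containing $p(a,b)$ are extended bilinearly to all $a,b$. For $n\in\mathbb Z$ put $i_{z,w}(z-w)^n=\sum_{j\ge0}\binom nj(-w)^jz^{n-j}$, $i_{w,z}(z-w)^n=\sum_{j\ge0}\binom nj z^j(-w)^{n-j}$, and $\delta(z,w)=\sum_{n\in\mathbb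 Z}z^{-n-1}w^n$, where $\binom nj=n(n-1)\cdots(n-j+1)/j!$. For every state-field correspondence, every product and sum below is well defined: each coefficient, applied to a vector, is a finite sum. (1) In a vertex algebra $V$, for all $a,b\in V$ and $n\in\mathbb Z$, $$Y(a,z)Y(b,w)\,i_{z,w}(z-w)^n-p(a,b)\,Y(b,w)Y(a,z)\,i_{w,z}(z-w)^n=\sum_{j\ge0}Y(a_{(n+j)}b,w)\,\frac{\partial_w^j\delta(z,w)}{j!}.\qquad(*)$$ (2) For every state-field correspondence and all $a,b\in V$, $n\in\mathbb Z$, identity $(*)$ is equivalent to the validity, for all $c\in V$ and $s,t\in\mathbb Z$, of $$\sum_{j\ge0}\binom sj\big(a_{(n+j)}b\big)_{(s+t-j)}c=\sum_{j\ge0}(-1)^j\binom nj\Big(a_{(n+s-j)}\big(b_{(j+t)}c\big)-(-1)^n\,p(a,b)\,b_{(n+t-j)}\big(a_{(j+s)}c\big)\Big).\qquad(**)$$ (3) Consequently, in a vertex algebra, $(**)$ (the original Borcherds identity) holds for all $a,b,c\in V$ and $n,s,t\in\mathbb Z$. -/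

import Mathlib

noncomputable section

namespace FormalVertex

/-! ### Formal distributions -/

/-- `M`-valued formal distributions in one variable: `a i` is the coefficient of `z ^ i`. -/
abbrev Dist₁ (M : Type*) := ℤ → M

/-- `M`-valued formal distributions in two variables `z`, `w`: `F i k` is the coefficient of
`z ^ i * w ^ k`. -/
abbrev Dist₂ (M : Type*) := ℤ → ℤ → M

/-- The formal derivative `∂_z a(z)`. -/
def deriv₁ {M : Type*} [AddCommGroup M] (a : Dist₁ M) : Dist₁ M :=
  fun i => (i + 1) • a (i + 1)

/-- The formal derivative `∂_w F(z,w)`. -/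
def derivW {M : Type*} [AddCommGroup M] (F : Dist₂ M) : Dist₂ M :=
  fun i k => (k + 1) • F i (k + 1)

/-- The product `(z - w) F(z,w)`. -/
def mulSub {M : Type*} [AddCommGroup M] (F : Dist₂ M) : Dist₂ M :=
  fun i k => F (i - 1) k - F i (k - 1)

/-- `F(z,w)` is local: `(z - w) ^ n F(z,w) = 0` for all large `n`. -/
def IsLocal {M : Type*} [AddCommGroup M] (F : Dist₂ M) : Prop :=
  ∃ N : ℕ, ∀ n ≥ N, mulSub^[n] F = 0

/-- The expansion `i_{z,w} (z - w) ^ n = ∑_{j ≥ 0} (n choose j) (-w) ^ j z ^ (n - j)`. -/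
def expandZW (n : ℤ) : Dist₂ ℂ :=
  fun i k => if 0 ≤ k ∧ i + k = n then ((Ring.choose n k.toNat : ℤ) : ℂ) * (-1 : ℂ) ^ k else 0

/-- The expansion `i_{w,z} (z - w) ^ n = ∑_{j ≥ 0} (n choose j) z ^ j (-w) ^ (n - j)`. -/
def expandWZ (n : ℤ) : Dist₂ ℂ :=
  fun i k => if 0 ≤ i ∧ i + k = n then ((Ring.choose n i.toNat : ℤ) : ℂ) * (-1 : ℂ) ^ k else 0

/-- The formal delta distribution `δ(z,w) = ∑_n z ^ (-n-1) w ^ n`. -/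
def delta : Dist₂ ℂ := fun i k => if i + k = -1 then 1 else 0

/-- The divided derivative `∂_w ^ j δ(z,w) / j!`. -/
def deltaDeriv (j : ℕ) : Dist₂ ℂ := ((j.factorial : ℂ)⁻¹) • derivW^[j] delta

section Product

variable {V : Type*} [AddCommGroup V] [Module ℂ V]

/-- The product of the scalar distribution `f(z,w)` with the `End(V)`-valued distribution `F(z,w)`
is well defined: every coefficient, applied to any vector, is a sum with finitely many nonzero
terms. -/
def Multipliable (f : Dist₂ ℂ) (F : Dist₂ (Module.End ℂ V)) : Prop :=
  ∀ (p q : ℤ) (v : V),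
    (Function.support fun x : ℤ × ℤ => f x.1 x.2 • F (p - x.1) (q - x.2) v).Finite

open Classical in
/-- The product `f(z,w) F(z,w)` of a scalar and an `End(V)`-valued distribution, by the Cauchy
product formula (and `0` if this formula makes no sense). -/
def mul (f : Dist₂ ℂ) (F : Dist₂ (Module.End ℂ V)) : Dist₂ (Module.End ℂ V) :=
  if h : Multipliable f F then fun p q =>
    { toFun := fun v => ∑ᶠ x : ℤ × ℤ, f x.1 x.2 • F (p - x.1) (q - x.2) v
      map_add' := fun u v => by
        rw [← finsum_add_distrib (h p q u) (h p q v)]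
        simp only [map_add, smul_add]
      map_smul' := fun r v => by
        rw [RingHom.id_apply, smul_finsum' r (h p q v)]
        simp only [map_smul, smul_comm r] }
  else 0

/-- `A(z) B(w)`. -/
def prodZW (A B : VertexOperator ℂ V) : Dist₂ (Module.End ℂ V) :=
  fun i k => HVertexOperator.coeff A i ∘ₗ HVertexOperator.coeff B k

/-- `B(w) A(z)`. -/
def prodWZ (B A : VertexOperator ℂ V) : Dist₂ (Module.End ℂ V) :=
  fun i k => HVertexOperator.coeff B k ∘ₗ HVertexOperator.coeff A i

/-- `A(w)`, viewed as a distribution in `z` and `w`. -/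
def inW (A : VertexOperator ℂ V) : Dist₂ (Module.End ℂ V) :=
  fun i k => if i = 0 then HVertexOperator.coeff A k else 0

end Product

section Super

variable {V : Type*} [AddCommGroup V] [Module ℂ V] (𝒱 : ZMod 2 → Submodule ℂ V)

/-- The sign `(-1) ^ (i j)` attached to two parities. -/
def paritySign (i j : ZMod 2) : ℤ := (-1) ^ (i.val * j.val)

/-- `p(a,b) B(a,b)` for an expression `B` that is bilinear in `a` and `b`: it equals
`(-1) ^ (p(a) p(b)) B(a,b)` for homogeneous `a`, `b`, and is extended bilinearly to all `a`, `b`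
through their homogeneous components. -/
def signed [DirectSum.Decomposition 𝒱] {M : Type*} [AddCommGroup M] (B : V → V → M) (a b : V) : M :=
  ∑ i : ZMod 2, ∑ j : ZMod 2,
    paritySign i j • B (DirectSum.decompose 𝒱 a i : V) (DirectSum.decompose 𝒱 b j : V)

theorem signed_of_mem [DirectSum.Decomposition 𝒱] {M : Type*} [AddCommGroup M] (B : V → V → M)
    (hl : ∀ b, B 0 b = 0) (hr : ∀ a, B a 0 = 0) {i j : ZMod 2} {a b : V}
    (ha : a ∈ 𝒱 i) (hb : b ∈ 𝒱 j) : signed 𝒱 B a b = paritySign i j • B a b := by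
  unfold signed
  rw [Finset.sum_eq_single i, Finset.sum_eq_single j]
  · rw [DirectSum.decompose_of_mem_same 𝒱 ha, DirectSum.decompose_of_mem_same 𝒱 hb]
  · intro j' _ hj
    rw [DirectSum.decompose_of_mem_ne 𝒱 hb (Ne.symm hj), hr, smul_zero]
  · simp
  · intro i' _ hi
    refine Finset.sum_eq_zero fun j' _ => ?_
    rw [DirectSum.decompose_of_mem_ne 𝒱 ha (Ne.symm hi), hl, smul_zero]
  · simp

/-- A state-field correspondence on the superspace `V = 𝒱 0 ⊕ 𝒱 1`: a linear, parity preserving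
map `Y` from `V` to the `End(V)`-valued fields, i.e. to the distributions `A(z)` with
`A(z) v ∈ V[[z]][z⁻¹]` for all `v`. -/
structure StateField where
  /-- The field `Y(a,z)`. -/
  Y : V →ₗ[ℂ] VertexOperator ℂ V
  parity : ∀ (i j : ZMod 2) (a b : V), a ∈ 𝒱 i → b ∈ 𝒱 j → ∀ n : ℤ,
    VertexOperator.ncoeff (Y a) n b ∈ 𝒱 (i + j)

namespace StateField

variable {𝒱}

/-- The `n`-th product `a_(n) b`, where `Y(a,z) b = ∑_n a_(n) b z ^ (-n-1)`. -/
def nprod (S : StateField 𝒱) (a : V) (n : ℤ) (b : V) : V := VertexOperator.ncoeff (S.Y a) n b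

variable [DirectSum.Decomposition 𝒱]

/-- `p(a,b) Y(b,w) Y(a,z)`. -/
def signedSwap (S : StateField 𝒱) (a b : V) : Dist₂ (Module.End ℂ V) :=
  signed 𝒱 (fun a b => prodWZ (S.Y b) (S.Y a)) a b

/-- The superbracket `[Y(a,z), Y(b,w)] = Y(a,z) Y(b,w) - p(a,b) Y(b,w) Y(a,z)`. -/
def bracket (S : StateField 𝒱) (a b : V) : Dist₂ (Module.End ℂ V) :=
  prodZW (S.Y a) (S.Y b) - S.signedSwap a b

/-- The Borcherds identity for `a`, `b`, `n` as an equality of formal distributions: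
`Y(a,z) Y(b,w) i_{z,w} (z-w)^n - p(a,b) Y(b,w) Y(a,z) i_{w,z} (z-w)^n
  = ∑_{j ≥ 0} Y(a_(n+j) b, w) ∂_w^j δ(z,w) / j!`. -/
def DistIdentity (S : StateField 𝒱) (a b : V) (n : ℤ) : Prop :=
  mul (expandZW n) (prodZW (S.Y a) (S.Y b)) - mul (expandWZ n) (S.signedSwap a b)
    = ∑ᶠ j : ℕ, mul (deltaDeriv j) (inW (S.Y (S.nprod a (n + j) b)))

/-- All products and sums in `DistIdentity` are well defined. -/
def DistWellDefined (S : StateField 𝒱) (a b : V) (n : ℤ) : Prop :=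
  Multipliable (expandZW n) (prodZW (S.Y a) (S.Y b)) ∧
  Multipliable (expandWZ n) (S.signedSwap a b) ∧
  (∀ j : ℕ, Multipliable (deltaDeriv j) (inW (S.Y (S.nprod a (n + j) b)))) ∧
  (Function.support fun j : ℕ => mul (deltaDeriv j) (inW (S.Y (S.nprod a (n + j) b)))).Finite

/-- The `j`-th term
`(s choose j) (a_(n+j) b)_(s+t-j) c`. -/
def modeTermRight (S : StateField 𝒱) (a b c : V) (n s t : ℤ) (j : ℕ) : V :=
  Ring.choose s j • S.nprod (S.nprod a (n + j) b) (s + t - j) c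

/-- The `j`-th term
`(-1)^j (n choose j) (a_(n+s-j) (b_(j+t) c) - (-1)^n p(a,b) b_(n+t-j) (a_(j+s) c))`. -/
def modeTermLeft (S : StateField 𝒱) (a b c : V) (n s t : ℤ) (j : ℕ) : V :=
  ((-1) ^ j * Ring.choose n j) •
    (S.nprod a (n + s - j) (S.nprod b (j + t) c)
      - n.negOnePow •
          signed 𝒱 (fun a b => S.nprod b (n + t - j) (S.nprod a (j + s) c)) a b)

/-- The Borcherds identity in modes. -/
def ModeIdentity (S : StateField 𝒱) (a b c : V) (n s t : ℤ) : Prop :=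
  ∑ᶠ j : ℕ, S.modeTermRight a b c n s t j = ∑ᶠ j : ℕ, S.modeTermLeft a b c n s t j

/-- Both sums in `ModeIdentity` are finite. -/
def ModeWellDefined (S : StateField 𝒱) (a b c : V) (n s t : ℤ) : Prop :=
  (Function.support (S.modeTermRight a b c n s t)).Finite ∧
  (Function.support (S.modeTermLeft a b c n s t)).Finite

end StateField

/-- A vertex algebra `(V, |0⟩, T, Y)` on the superspace `V = 𝒱 0 ⊕ 𝒱 1`. -/
structure VertexAlgebra [DirectSum.Decomposition 𝒱] extends StateField 𝒱 where
  /-- The vacuum vector `|0⟩`. -/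
  vac : V
  vac_even : vac ∈ 𝒱 0
  /-- The infinitesimal translation operator. -/
  T : Module.End ℂ V
  T_even : ∀ (i : ZMod 2) (a : V), a ∈ 𝒱 i → T a ∈ 𝒱 i
  /-- `Y(|0⟩,z) = Id_V`. -/
  Y_vac : ∀ i : ℤ, HVertexOperator.coeff (Y vac) i = if i = 0 then LinearMap.id else 0
  /-- `Y(a,z)|0⟩ ∈ V[[z]]` has constant term `a`. -/
  Y_apply_vac : ∀ (a : V) (i : ℤ), i ≤ 0 →
    HVertexOperator.coeff (Y a) i vac = if i = 0 then a else 0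
  T_vac : T vac = 0
  /-- `[T, Y(a,z)] = ∂_z Y(a,z)`. -/
  translation : ∀ a : V,
    (fun i => T ∘ₗ HVertexOperator.coeff (Y a) i - HVertexOperator.coeff (Y a) i ∘ₗ T)
      = deriv₁ (HVertexOperator.coeff (Y a))
  /-- The fields `Y(a,z)`, `Y(b,w)` are mutually local. -/
  locality : ∀ a b : V, IsLocal (toStateField.bracket a b)

end Super

end FormalVertex

end

noncomputable section

namespace FormalVertex

/-! ### Binomial coefficients, finite sums and the derivatives of the delta distribution. -/

section Prelim

/-! The equivalence of the two identities is a comparison of coefficients: the coefficient of `z ^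
(-s-1) w ^ (-t-1)`, applied to `c`, is the mode identity for `s`, `t`. Finiteness comes from the
field property. The mode identity is therefore the one proved for vertex algebras, and the identity
of distributions is deduced from it.

By additivity, `a`, `b`, `c` may be taken homogeneous, so that `p(a,b)` is a fixed sign. Let
`D(z,w)` be the difference of the two sides, as an operator-valued distribution. The argument that
`D = 0` follows the pattern of Goddard's uniqueness theorem.

(i) `D(z,w)|0⟩ = 0` (`deltaExpansion_vac`). For large `n` both sides vanish, by locality and
truncation. Multiplication by `z - w` raises `n` by one on each side, so descending in `n` leaves
only the residue in `z` to be compared. That is `nprod_nprod_vac`, a consequence of translation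
covariance.

(ii) `D(z,w)` is local with `Y(c,x)` on the vacuum: `(z-x)^m (w-x)^m` kills the supercommutator for
large `m`. For the products of fields this is the Leibniz rule (`tripleBracket_local`); for the
delta terms it is locality of `a_(n+l) b` with `c` (`deltaTerm_local`).

(iii) Hence `(z-x)^m (w-x)^m D(z,w) Y(c,x)|0⟩ = 0`. As `Y(c,x)|0⟩` has no negative powers of `x`,
the constant term in `x` can be extracted, and it is `D(z,w) c = 0`
(`deltaExpansion_eq_expandedBracket`). -/

theorem succ_mul_choose (r : ℤ) (j : ℕ) :
    ((j : ℤ) + 1) * Ring.choose r (j + 1) = Ring.choose r j * (r - j) := by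
  have h := Ring.choose_smul_choose r (Nat.le_succ j)
  simpa [Ring.choose_one_right] using h

theorem finsum_eq_finsum_comp {α β M : Type*} [AddCommMonoid M] {g : β → α}
    (hg : Function.Injective g) {f : α → M} (hf : ∀ x, f x ≠ 0 → ∃ j, g j = x) :
    ∑ᶠ x, f x = ∑ᶠ j, f (g j) := by
  rw [← finsum_mem_range hg, ← finsum_mem_univ f]
  refine finsum_mem_inter_support_eq' f _ _ fun x hx => ?_
  simpa using hf x hx

theorem finite_support_of_forall_ge {M : Type*} [Zero M] {f : ℕ → M} {J : ℕ}
    (h : ∀ j ≥ J, f j = 0) : (Function.support f).Finite :=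
  (Set.finite_Iio J).subset fun j hj => by
    by_contra hn
    exact hj (h j (not_lt.mp hn))

theorem finsum_eq_sum_range {M : Type*} [AddCommMonoid M] {f : ℕ → M} {J : ℕ}
    (h : ∀ j ≥ J, f j = 0) : ∑ᶠ j, f j = ∑ j ∈ Finset.range J, f j := by
  refine finsum_eq_sum_of_support_subset f fun j hj => ?_
  by_contra hn
  exact hj (h j (by simpa using hn))

/-- The coefficients of `∂_w ^ j δ(z,w) / j!`. -/
theorem deltaDeriv_apply (j : ℕ) (i k : ℤ) :
    deltaDeriv j i k = if i + k = -1 - j then ((Ring.choose (-1 - i) j : ℤ) : ℂ) else 0 := by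
  have key : ∀ (j : ℕ) (i k : ℤ), derivW^[j] delta i k =
      if i + k = -1 - j then (j.factorial : ℂ) * ((Ring.choose (-1 - i) j : ℤ) : ℂ) else 0 := by
    intro j
    induction j with
    | zero => intro i k; simp [delta]
    | succ j ih =>
      intro i k
      rw [Function.iterate_succ_apply', derivW, ih]
      by_cases h : i + k = -1 - (j + 1 : ℕ)
      · rw [if_pos h, if_pos (by push_cast at h; omega)]
        have hk : k + 1 = -1 - i - j := by push_cast at h; omega
        have h2 := congrArg (Int.cast : ℤ → ℂ) (succ_mul_choose (-1 - i) j)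
        rw [hk, zsmul_eq_mul, Nat.factorial_succ]
        push_cast at h2 ⊢
        linear_combination (-(j.factorial : ℂ)) * h2
      · rw [if_neg h, if_neg (by push_cast at h; omega), smul_zero]
  have hj : (j.factorial : ℂ) ≠ 0 := by exact_mod_cast j.factorial_ne_zero
  simp only [deltaDeriv, Pi.smul_apply, key, smul_eq_mul]
  split_ifs
  · field_simp
  · simp

end Prelim

/-! ### Well-definedness, and the coefficients of the identity of distributions. -/

section Modes

variable {V : Type*} [AddCommGroup V] [Module ℂ V] {𝒱 : ZMod 2 → Submodule ℂ V}

theorem ncoeff_eventually_zero (A : VertexOperator ℂ V) (v : V) :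
    ∃ N : ℤ, ∀ n ≥ N, VertexOperator.ncoeff A n v = 0 := by
  refine ⟨-HahnSeries.order ((HahnModule.of ℂ).symm (A v)), fun n hn => ?_⟩
  exact VertexOperator.ncoeff_eq_zero_of_lt_order A n v (by omega)

theorem mul_apply {f : Dist₂ ℂ} {F : Dist₂ (Module.End ℂ V)} (h : Multipliable f F)
    (p q : ℤ) (v : V) :
    mul f F p q v = ∑ᶠ x : ℤ × ℤ, f x.1 x.2 • F (p - x.1) (q - x.2) v := by
  rw [mul, dif_pos h]
  rfl

namespace StateField

variable (S : StateField 𝒱)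

theorem coeff_eq (a : V) (i : ℤ) (v : V) :
    HVertexOperator.coeff (S.Y a) i v = S.nprod a (-i - 1) v := by
  rw [VertexOperator.coeff_eq_ncoeff]; rfl

theorem nprod_add_left (a a' : V) (n : ℤ) (v : V) :
    S.nprod (a + a') n v = S.nprod a n v + S.nprod a' n v := by
  simp [nprod]

theorem nprod_add_right (a : V) (n : ℤ) (v v' : V) :
    S.nprod a n (v + v') = S.nprod a n v + S.nprod a n v' := by
  simp [nprod]

@[simp] theorem nprod_zero_left (n : ℤ) (v : V) : S.nprod 0 n v = 0 := by
  simp [nprod]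

@[simp] theorem nprod_zero_right (a : V) (n : ℤ) : S.nprod a n 0 = 0 := by
  simp [nprod]

theorem nprod_sub_right (a : V) (n : ℤ) (v v' : V) :
    S.nprod a n (v - v') = S.nprod a n v - S.nprod a n v' := by
  simp [nprod]

theorem nprod_zsmul_right (a : V) (n m : ℤ) (v : V) :
    S.nprod a n (m • v) = m • S.nprod a n v := by
  simp [nprod]

theorem nprod_sum_right {ι : Type*} (a : V) (n : ℤ) (I : Finset ι) (f : ι → V) :
    S.nprod a n (∑ l ∈ I, f l) = ∑ l ∈ I, S.nprod a n (f l) := by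
  simp [nprod]

theorem nprod_eventually_zero (a v : V) : ∃ N : ℤ, ∀ n ≥ N, S.nprod a n v = 0 :=
  ncoeff_eventually_zero _ _

theorem exists_nprod_add_eq_zero (a v : V) (n : ℤ) :
    ∃ J : ℕ, ∀ q ≥ (J : ℤ), S.nprod a (q + n) v = 0 := by
  obtain ⟨N, hN⟩ := S.nprod_eventually_zero a v
  exact ⟨(N - n).toNat, fun q hq => hN _ (by omega)⟩

theorem prodZW_apply (a b : V) (i k : ℤ) (v : V) :
    prodZW (S.Y a) (S.Y b) i k v = S.nprod a (-i - 1) (S.nprod b (-k - 1) v) := by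
  simp only [prodZW, LinearMap.comp_apply, coeff_eq]

theorem injective_sub_natCast_prod (n : ℤ) :
    Function.Injective fun j : ℕ => ((n - j, (j : ℤ)) : ℤ × ℤ) := fun j k h => by
  simpa using (Prod.ext_iff.mp h).2

theorem injective_natCast_prod_sub (n : ℤ) :
    Function.Injective fun j : ℕ => (((j : ℤ), n - j) : ℤ × ℤ) := fun j k h => by
  simpa using (Prod.ext_iff.mp h).1

theorem expandZW_ne_zero {n : ℤ} {x : ℤ × ℤ} (h : expandZW n x.1 x.2 ≠ 0) :
    ∃ j : ℕ, ((n - j, (j : ℤ)) : ℤ × ℤ) = x := by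
  rw [expandZW] at h
  have := (ite_ne_right_iff.mp h).1
  exact ⟨x.2.toNat, Prod.ext (by simp only; omega) (by simp only; omega)⟩

theorem expandWZ_ne_zero {n : ℤ} {x : ℤ × ℤ} (h : expandWZ n x.1 x.2 ≠ 0) :
    ∃ j : ℕ, (((j : ℤ), n - j) : ℤ × ℤ) = x := by
  rw [expandWZ] at h
  have := (ite_ne_right_iff.mp h).1
  exact ⟨x.1.toNat, Prod.ext (by simp only; omega) (by simp only; omega)⟩

theorem expandZW_apply (n : ℤ) (j : ℕ) :
    expandZW n (n - j) j = (((-1) ^ j * Ring.choose n j : ℤ) : ℂ) := by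
  simp [expandZW, mul_comm]

theorem expandWZ_apply (n : ℤ) (j : ℕ) :
    expandWZ n j (n - j) = (((-1) ^ j * Ring.choose n j * (n.negOnePow : ℤ) : ℤ) : ℂ) := by
  have h : ((n.negOnePow : ℤ) : ℂ) = (-1 : ℂ) ^ n := by
    rcases Int.even_or_odd n with hn | hn
    · simp [Int.negOnePow_even n hn, hn.neg_one_zpow]
    · simp [Int.negOnePow_odd n hn, hn.neg_one_zpow]
  have h2 : (-1 : ℂ) ^ (n - j) = (-1) ^ n * (-1) ^ j := by
    rw [zpow_sub₀ (by norm_num), zpow_natCast, div_eq_mul_inv, ← inv_pow]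
    norm_num
  simp only [expandWZ, Int.toNat_natCast, Int.cast_mul, h, h2]
  rw [if_pos ⟨by omega, by omega⟩]
  push_cast
  ring

/-- The expansion is supported on the pairs `(n - j, j)` with `j ≥ 0`, and large `j` pushes the mode
of `b`, which acts first, into the range where it kills `v`. -/
theorem multipliable_expandZW (a b : V) (n : ℤ) :
    Multipliable (expandZW n) (prodZW (S.Y a) (S.Y b)) := by
  intro p q v
  obtain ⟨J, hJ⟩ := S.exists_nprod_add_eq_zero b v (-q - 1)
  refine ((Set.finite_Iio J).image fun j : ℕ => ((n - j, (j : ℤ)) : ℤ × ℤ)).subset fun x hx => ?_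
  obtain ⟨j, rfl⟩ := expandZW_ne_zero (left_ne_zero_of_smul hx)
  refine ⟨j, ?_, rfl⟩
  by_contra hj
  refine hx ?_
  have h := hJ j (by simpa using hj)
  simp only [prodZW_apply]
  rw [show -(q - (j : ℤ)) - 1 = j + (-q - 1) by ring, h, nprod_zero_right, smul_zero]

theorem deltaDeriv_smul_inW_ne_zero {A : VertexOperator ℂ V} {j : ℕ} {p q : ℤ} {v : V}
    {x : ℤ × ℤ} (h : deltaDeriv j x.1 x.2 • inW A (p - x.1) (q - x.2) v ≠ 0) :
    (p, -1 - j - p) = x := by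
  rw [deltaDeriv_apply, inW] at h
  have h1 := (ite_ne_right_iff.mp (left_ne_zero_of_smul h)).1
  have h2 : p - x.1 = 0 := by
    by_contra hn
    simp [hn] at h
  exact Prod.ext (by simp only; omega) (by simp only; omega)

theorem multipliable_deltaDeriv (A : VertexOperator ℂ V) (j : ℕ) :
    Multipliable (deltaDeriv j) (inW A) := fun p _ _ =>
  (Set.finite_singleton (p, -1 - j - p)).subset fun _ hx =>
    (deltaDeriv_smul_inW_ne_zero hx).symm

/-- A field in `w` alone has only the power `z ^ 0`, and the delta term is homogeneous of degree `-1
- j`, so exactly one pair of exponents contributes. -/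
theorem mul_deltaDeriv_apply (A : VertexOperator ℂ V) (j : ℕ) (p q : ℤ) (v : V) :
    mul (deltaDeriv j) (inW A) p q v
      = Ring.choose (-1 - p) j • VertexOperator.ncoeff A (-p - q - 2 - j) v := by
  rw [mul_apply (multipliable_deltaDeriv A j),
    finsum_eq_single _ (p, -1 - (j : ℤ) - p) fun x hx => by
      by_contra h
      exact hx (deltaDeriv_smul_inW_ne_zero h).symm]
  simp only [deltaDeriv_apply, inW, sub_self, if_true, VertexOperator.coeff_eq_ncoeff]
  rw [if_pos (by ring), Int.cast_smul_eq_zsmul,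
    show -(q - (-1 - (j : ℤ) - p)) - 1 = -p - q - 2 - j by ring]

theorem exists_mul_deltaDeriv_eq_zero (a b : V) (n : ℤ) :
    ∃ J : ℕ, ∀ j ≥ J, mul (deltaDeriv j) (inW (S.Y (S.nprod a (n + j) b))) = 0 := by
  obtain ⟨J, hJ⟩ := S.exists_nprod_add_eq_zero a b n
  refine ⟨J, fun j hj => ?_⟩
  ext p q v
  rw [mul_deltaDeriv_apply, add_comm n, hJ j (by exact_mod_cast hj)]
  simp

theorem distIdentity_right_apply (a b : V) (n p q : ℤ) (v : V) :
    (∑ᶠ j : ℕ, mul (deltaDeriv j) (inW (S.Y (S.nprod a (n + j) b)))) p q v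
      = ∑ᶠ j : ℕ, S.modeTermRight a b v n (-p - 1) (-q - 1) j := by
  obtain ⟨J, hJ⟩ := S.exists_mul_deltaDeriv_eq_zero a b n
  have h : ∀ j : ℕ, mul (deltaDeriv j) (inW (S.Y (S.nprod a (n + j) b))) p q v
      = S.modeTermRight a b v n (-p - 1) (-q - 1) j := fun j => by
    rw [mul_deltaDeriv_apply, modeTermRight, nprod.eq_1 S (S.nprod a (n + j) b)]
    rw [show -1 - p = -p - 1 by ring, show -p - q - 2 - (j : ℤ) = -p - 1 + (-q - 1) - j by ring]
  rw [finsum_eq_sum_range hJ, finsum_eq_sum_range (J := J)]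
  · simp only [Finset.sum_apply, LinearMap.sum_apply, h]
  · intro j hj
    rw [← h, hJ j hj]
    rfl

variable [DirectSum.Decomposition 𝒱]

theorem signedSwap_apply (a b : V) (i k : ℤ) (v : V) :
    S.signedSwap a b i k v
      = signed 𝒱 (fun a b => S.nprod b (-k - 1) (S.nprod a (-i - 1) v)) a b := by
  simp only [signedSwap, signed, Finset.sum_apply, Pi.smul_apply, LinearMap.sum_apply,
    LinearMap.smul_apply, prodWZ, LinearMap.comp_apply, coeff_eq]

/-- The inner mode of each homogeneous component of `a` already kills `v`, so the bound does not
depend on the outer index `p`. -/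
theorem exists_signed_eq_zero (a b v : V) (s : ℤ) :
    ∃ J : ℕ, ∀ q ≥ (J : ℤ), ∀ p,
      signed 𝒱 (fun a b => S.nprod b p (S.nprod a (q + s) v)) a b = 0 := by
  choose J hJ using fun i : ZMod 2 =>
    S.exists_nprod_add_eq_zero (DirectSum.decompose 𝒱 a i : V) v s
  refine ⟨∑ i, J i, fun q hq p => Finset.sum_eq_zero fun i _ => Finset.sum_eq_zero fun j _ => ?_⟩
  have : J i ≤ ∑ i, J i := 
    Finset.single_le_sum (f := J) (fun _ _ => Nat.zero_le _) (Finset.mem_univ i)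
  beta_reduce
  rw [hJ i q (by omega), nprod_zero_right, smul_zero]

theorem multipliable_expandWZ (a b : V) (n : ℤ) :
    Multipliable (expandWZ n) (S.signedSwap a b) := by
  intro p q v
  obtain ⟨J, hJ⟩ := S.exists_signed_eq_zero a b v (-p - 1)
  refine ((Set.finite_Iio J).image fun j : ℕ => (((j : ℤ), n - j) : ℤ × ℤ)).subset fun x hx => ?_
  obtain ⟨j, rfl⟩ := expandWZ_ne_zero (left_ne_zero_of_smul hx)
  refine ⟨j, ?_, rfl⟩
  by_contra hj
  refine hx ?_
  have h := hJ j (by simpa using hj)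
  simp only [signedSwap_apply]
  rw [show -(p - (j : ℤ)) - 1 = j + (-p - 1) by ring, h, smul_zero]

theorem distWellDefined (a b : V) (n : ℤ) : S.DistWellDefined a b n := by
  obtain ⟨J, hJ⟩ := S.exists_mul_deltaDeriv_eq_zero a b n
  exact ⟨S.multipliable_expandZW a b n, S.multipliable_expandWZ a b n,
    fun j => multipliable_deltaDeriv _ j, finite_support_of_forall_ge hJ⟩

theorem modeWellDefined (a b c : V) (n s t : ℤ) : S.ModeWellDefined a b c n s t := by
  constructor
  · obtain ⟨J, hJ⟩ := S.exists_nprod_add_eq_zero a b n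
    refine finite_support_of_forall_ge (J := J) fun j hj => ?_
    rw [modeTermRight, add_comm n, hJ j (by exact_mod_cast hj), nprod_zero_left, smul_zero]
  · obtain ⟨J, hJ⟩ := S.exists_nprod_add_eq_zero b c t
    obtain ⟨K, hK⟩ := S.exists_signed_eq_zero a b c s
    refine finite_support_of_forall_ge (J := J + K) fun j hj => ?_
    rw [modeTermLeft, hJ j (by omega), hK j (by omega)]
    simp

/-- The coefficient of `z ^ p w ^ q` in the left-hand side of the Borcherds identity of
distributions is the left-hand side of the mode identity. -/
theorem distIdentity_left_apply (a b : V) (n p q : ℤ) (v : V) :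
    (mul (expandZW n) (prodZW (S.Y a) (S.Y b)) - mul (expandWZ n) (S.signedSwap a b)) p q v
      = ∑ᶠ j : ℕ, S.modeTermLeft a b v n (-p - 1) (-q - 1) j := by
  rw [Pi.sub_apply, Pi.sub_apply, LinearMap.sub_apply, mul_apply (S.multipliable_expandZW a b n),
    mul_apply (S.multipliable_expandWZ a b n),
    finsum_eq_finsum_comp (injective_sub_natCast_prod n)
      fun x hx => expandZW_ne_zero (left_ne_zero_of_smul hx),
    finsum_eq_finsum_comp (injective_natCast_prod_sub n)
      fun x hx => expandWZ_ne_zero (left_ne_zero_of_smul hx),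
    ← finsum_sub_distrib]
  · refine finsum_congr fun j => ?_
    simp only [modeTermLeft, expandZW_apply, expandWZ_apply, prodZW_apply, signedSwap_apply,
      Int.cast_smul_eq_zsmul, smul_sub, Units.smul_def, smul_smul]
    rw [show -(p - (n - (j : ℤ))) - 1 = n + (-p - 1) - j by ring,
      show -(q - (j : ℤ)) - 1 = j + (-q - 1) by ring,
      show -(p - (j : ℤ)) - 1 = j + (-p - 1) by ring,
      show -(q - (n - (j : ℤ))) - 1 = n + (-q - 1) - j by ring]
  · exact (S.multipliable_expandZW a b n p q v).preimage
      (injective_sub_natCast_prod n).injOn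
  · exact (S.multipliable_expandWZ a b n p q v).preimage
      (injective_natCast_prod_sub n).injOn

theorem distIdentity_iff (a b : V) (n : ℤ) :
    S.DistIdentity a b n ↔ ∀ (c : V) (s t : ℤ), S.ModeIdentity a b c n s t := by
  constructor
  · intro h c s t
    have h' := congrArg (fun F : Dist₂ (Module.End ℂ V) => F (-s - 1) (-t - 1) c) h
    simp only [distIdentity_left_apply, distIdentity_right_apply] at h'
    simpa [ModeIdentity] using h'.symm
  · intro h
    unfold DistIdentity
    funext p q
    ext v
    rw [distIdentity_left_apply, distIdentity_right_apply]
    exact (h v _ _).symm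

end StateField

end Modes

/-! ### Pairing modes with the expansion of `(z - w) ^ n`. -/

section BinomSum

variable {V : Type*} [AddCommGroup V]

/-- `g p q` vanishes for large `q`, uniformly in `p`. -/
def Truncated (g : ℤ → ℤ → V) : Prop := ∃ J : ℤ, ∀ q ≥ J, ∀ p, g p q = 0

/-- The sum `∑_{j ≥ 0} (-1)^j (n choose j) g (n - j) j`, i.e. the coefficient pairing of `g` with
the expansion of `(z - w) ^ n`. -/
def binomSum (n : ℤ) (g : ℤ → ℤ → V) : V :=
  ∑ᶠ j : ℕ, ((-1) ^ j * Ring.choose n j) • g (n - j) j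

theorem Truncated.exists_nat {g : ℤ → ℤ → V} (hg : Truncated g) :
    ∃ J : ℕ, ∀ q ≥ (J : ℤ), ∀ p, g p q = 0 := by
  obtain ⟨J, hJ⟩ := hg
  exact ⟨J.toNat, fun q hq => hJ q (by omega)⟩

theorem Truncated.sub {g h : ℤ → ℤ → V} (hg : Truncated g) (hh : Truncated h) :
    Truncated fun p q => g p q - h p q := by
  obtain ⟨J, hJ⟩ := hg
  obtain ⟨K, hK⟩ := hh
  exact ⟨max J K, fun q hq p => by
    beta_reduce
    rw [hJ q (le_of_max_le_left hq), hK q (le_of_max_le_right hq), sub_zero]⟩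

theorem Truncated.map {W : Type*} [AddCommGroup W] {g : ℤ → ℤ → V} (hg : Truncated g)
    (f : ℤ → ℤ → V →+ W) : Truncated fun p q => f p q (g p q) := by
  obtain ⟨J, hJ⟩ := hg
  exact ⟨J, fun q hq p => by beta_reduce; rw [hJ q hq, map_zero]⟩

theorem Truncated.shift {g : ℤ → ℤ → V} (hg : Truncated g) (s t : ℤ) :
    Truncated fun p q => g (p + s) (q + t) := by
  obtain ⟨J, hJ⟩ := hg
  exact ⟨J - t, fun q hq p => hJ _ (by omega) _⟩

theorem binomSum_eq_sum_range {g : ℤ → ℤ → V} {J : ℕ} (hJ : ∀ q ≥ (J : ℤ), ∀ p, g p q = 0)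
    (n : ℤ) :
    binomSum n g = ∑ j ∈ Finset.range J, ((-1) ^ j * Ring.choose n j) • g (n - j) j :=
  finsum_eq_sum_range fun j hj => by rw [hJ j (by exact_mod_cast hj), smul_zero]

theorem binomSum_zero_left (g : ℤ → ℤ → V) : binomSum 0 g = g 0 0 := by
  rw [binomSum, finsum_eq_single _ 0]
  · simp
  · intro j hj
    rw [Ring.choose_zero_pos ℤ (Nat.pos_of_ne_zero hj), mul_zero, zero_smul]

theorem binomSum_sub {g h : ℤ → ℤ → V} (hg : Truncated g) (hh : Truncated h) (n : ℤ) :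
    binomSum n (fun p q => g p q - h p q) = binomSum n g - binomSum n h := by
  obtain ⟨J, hJ⟩ := hg.exists_nat
  obtain ⟨K, hK⟩ := hh.exists_nat
  rw [binomSum_eq_sum_range (J := J + K) (fun q hq p => by
      rw [hJ q (by push_cast at hq; omega), hK q (by push_cast at hq; omega), sub_zero]),
    binomSum_eq_sum_range (J := J + K) (fun q hq p => hJ q (by push_cast at hq; omega) p),
    binomSum_eq_sum_range (J := J + K) (fun q hq p => hK q (by push_cast at hq; omega) p),
    ← Finset.sum_sub_distrib]
  simp only [smul_sub]

theorem map_binomSum {W : Type*} [AddCommGroup W] (f : V →+ W) {g : ℤ → ℤ → V}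
    (hg : Truncated g) (n : ℤ) :
    f (binomSum n g) = binomSum n fun p q => f (g p q) := by
  obtain ⟨J, hJ⟩ := hg.exists_nat
  rw [binomSum_eq_sum_range hJ,
    binomSum_eq_sum_range (J := J) (fun q hq p => by rw [hJ q hq, map_zero]), map_sum]
  simp only [map_zsmul]

/-- Multiplying the expansion of `(z - w) ^ n` by `z - w`. -/
theorem binomSum_succ {g : ℤ → ℤ → V} (hg : Truncated g) (n : ℤ) :
    binomSum (n + 1) g
      = binomSum n (fun p q => g (p + 1) q) - binomSum n fun p q => g p (q + 1) := by
  obtain ⟨J, hJ⟩ := hg.exists_nat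
  -- The ranges have lengths `J + 1`, `J + 1`, `J`, so that splitting off `j = 0` from the first two
  -- aligns all three for Pascal's rule.
  rw [binomSum_eq_sum_range (J := J + 1) (fun q hq p => hJ q (by push_cast at hq; omega) p),
    binomSum_eq_sum_range (J := J + 1) (fun q hq p => hJ q (by push_cast at hq; omega) (p + 1)),
    binomSum_eq_sum_range (J := J) (fun q hq p => hJ (q + 1) (by omega) p),
    Finset.sum_range_succ' _ J, Finset.sum_range_succ' _ J, add_sub_right_comm (α := V),
    ← Finset.sum_sub_distrib]
  congr 1
  · refine Finset.sum_congr rfl fun j _ => ?_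
    rw [Ring.choose_succ_succ, show n + 1 - ((j + 1 : ℕ) : ℤ) = n - j by push_cast; ring,
      show n - ((j + 1 : ℕ) : ℤ) + 1 = n - j by push_cast; ring, Nat.cast_succ, ← sub_smul]
    congr 1
    ring
  · simp [sub_eq_add_neg, add_comm, add_left_comm]

/-- The model is `g p q = a_(p) b_(q+t-1)|0⟩`, where `hT` is translation covariance together with
`T|0⟩ = 0`. After `(j+1) (n choose j+1) = (n choose j) (n-j)` and a shift of index, the coefficients
`j` and `-(j + t)` add up to `-t`. -/
theorem binomSum_derivation (T : V →+ V) {g : ℤ → ℤ → V} (hg : Truncated g) (n t : ℤ)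
    (hT : ∀ p q, T (g p (q + 1)) = (-p) • g (p - 1) (q + 1) - (q + t) • g p q) :
    T (binomSum n fun p q => g p (q + 1)) = (-t) • binomSum n g := by
  obtain ⟨J, hJ⟩ := hg.exists_nat
  rw [binomSum_eq_sum_range (J := J) (fun q hq p => hJ (q + 1) (by omega) p),
    binomSum_eq_sum_range (J := J + 1) (fun q hq p => hJ q (by push_cast at hq; omega) p),
    map_sum]
  have h : ∀ j : ℕ, T (((-1) ^ j * Ring.choose n j) • g (n - j) (j + 1))
      = ((-1) ^ (j + 1) * (((j + 1 : ℕ) : ℤ) * Ring.choose n (j + 1)))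
            • g (n - (j + 1 : ℕ)) (j + 1 : ℕ)
          - ((-1) ^ j * Ring.choose n j * (j + t)) • g (n - j) j := fun j => by
    rw [map_zsmul, hT, smul_sub, smul_smul, smul_smul,
      show n - ((j + 1 : ℕ) : ℤ) = n - j - 1 by push_cast; ring, Nat.cast_succ, succ_mul_choose]
    congr 2
    ring
  rw [Finset.sum_congr rfl fun j _ => h j, Finset.sum_sub_distrib]
  have h2 : ∑ j ∈ Finset.range J, ((-1) ^ (j + 1) * (((j + 1 : ℕ) : ℤ) * Ring.choose n (j + 1)))
            • g (n - (j + 1 : ℕ)) (j + 1 : ℕ)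
      = ∑ j ∈ Finset.range (J + 1), ((-1) ^ j * ((j : ℤ) * Ring.choose n j)) • g (n - j) j := by
    rw [Finset.sum_range_succ' (fun j : ℕ => ((-1) ^ j * ((j : ℤ) * Ring.choose n j)) • g (n - j) j)]
    simp
  rw [h2, Finset.sum_range_succ, Finset.sum_range_succ, hJ J le_rfl]
  simp only [smul_zero, add_zero, Finset.smul_sum, ← Finset.sum_sub_distrib, smul_smul, ← sub_smul]
  refine Finset.sum_congr rfl fun j _ => ?_
  congr 1
  ring

end BinomSum

/-! ### Multiplication by `z - x` and `w - x` in three variables. -/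

section ThreeVariables

variable {V : Type*} [AddCommGroup V]

/-- Multiplication by `z - x`, on distributions in `z`, `w`, `x` given by their modes. -/
def mulZX (V : Type*) [AddCommGroup V] : Module.End ℤ (ℤ → ℤ → ℤ → V) where
  toFun H s t u := H (s + 1) t u - H s t (u + 1)
  map_add' G H := by funext s t u; simp only [Pi.add_apply]; abel
  map_smul' r H := by funext s t u; simp [smul_sub]

/-- Multiplication by `w - x`, on distributions in `z`, `w`, `x` given by their modes. -/
def mulWX (V : Type*) [AddCommGroup V] : Module.End ℤ (ℤ → ℤ → ℤ → V) where
  toFun H s t u := H s (t + 1) u - H s t (u + 1)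
  map_add' G H := by funext s t u; simp only [Pi.add_apply]; abel
  map_smul' r H := by funext s t u; simp [smul_sub]

theorem mulZX_apply (H : ℤ → ℤ → ℤ → V) (s t u : ℤ) :
    mulZX V H s t u = H (s + 1) t u - H s t (u + 1) := rfl

theorem mulWX_apply (H : ℤ → ℤ → ℤ → V) (s t u : ℤ) :
    mulWX V H s t u = H s (t + 1) u - H s t (u + 1) := rfl

theorem commute_mulZX_mulWX : Commute (mulZX V) (mulWX V) := by
  refine LinearMap.ext fun H => ?_
  funext s t u
  simp only [Module.End.mul_apply, mulZX_apply, mulWX_apply]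
  abel

/-- The exchange of `z` and `w`. -/
def swapZW (H : ℤ → ℤ → ℤ → V) : ℤ → ℤ → ℤ → V := fun s t u => H t s u

theorem mulZX_pow_swapZW (m : ℕ) (H : ℤ → ℤ → ℤ → V) :
    (mulZX V ^ m) (swapZW H) = swapZW ((mulWX V ^ m) H) := by
  induction m with
  | zero => rfl
  | succ m ih => rw [pow_succ', pow_succ', Module.End.mul_apply, ih]; rfl

theorem mulWX_pow_swapZW (m : ℕ) (H : ℤ → ℤ → ℤ → V) :
    (mulWX V ^ m) (swapZW H) = swapZW ((mulZX V ^ m) H) := by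
  induction m with
  | zero => rfl
  | succ m ih => rw [pow_succ', pow_succ', Module.End.mul_apply, ih]; rfl

/-- A distribution without negative powers of `x` whose product with `(z - x) ^ m` vanishes has
vanishing constant term in `x`. -/
theorem apply_neg_one_eq_zero_of_mulZX_pow {m : ℕ} {H : ℤ → ℤ → ℤ → V}
    (hH : ∀ s t, ∀ u ≥ 0, H s t u = 0) (h : ∀ s t, (mulZX V ^ m) H s t (-1) = 0) (s t : ℤ) :
    H s t (-1) = 0 := by
  induction m generalizing H s t with
  | zero => exact h s t
  | succ m ih =>
    have h' := ih (H := mulZX V H) (fun s t u hu => by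
      rw [mulZX_apply, hH _ _ u hu, hH _ _ (u + 1) (by omega), sub_zero])
      (by simpa only [pow_succ, Module.End.mul_apply] using h) (s - 1) t
    -- Since the mode `u = 0` vanishes, multiplication by `z - x` acts on the mode `u = -1` as a
    -- mere shift in `s`.
    rwa [mulZX_apply, sub_add_cancel, hH _ _ (-1 + 1) (by norm_num), sub_zero] at h'

theorem apply_neg_one_eq_zero_of_mulWX_pow {m : ℕ} {H : ℤ → ℤ → ℤ → V}
    (hH : ∀ s t, ∀ u ≥ 0, H s t u = 0) (h : ∀ s t, (mulWX V ^ m) H s t (-1) = 0) (s t : ℤ) :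
    H s t (-1) = 0 :=
  apply_neg_one_eq_zero_of_mulZX_pow (H := swapZW H) (fun s t => hH t s)
    (fun s t => by rw [mulZX_pow_swapZW]; exact h t s) t s

theorem mulWX_pow_nonneg (m : ℕ) {H : ℤ → ℤ → ℤ → V}
    (hH : ∀ s t, ∀ u ≥ 0, H s t u = 0) : ∀ s t, ∀ u ≥ 0, (mulWX V ^ m) H s t u = 0 := by
  induction m with
  | zero => exact hH
  | succ m ih =>
    intro s t u hu
    rw [pow_succ', Module.End.mul_apply, mulWX_apply, ih _ _ u hu, ih _ _ (u + 1) (by omega),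
      sub_zero]

/-- The product of `K(z,w,x)` with the expansion of `(z - w) ^ n` in the domain `|z| > |w|`. -/
def binomMul (n : ℤ) (K : ℤ → ℤ → ℤ → V) : ℤ → ℤ → ℤ → V :=
  fun s t u => binomSum n fun p q => K (p + s) (q + t) u

/-- Multiplication by a polynomial commutes with multiplication by the expansion. Truncation is
carried through the induction because `binomSum` splits over differences only for truncated
families. -/
theorem mulZX_pow_binomMul (m : ℕ) (n : ℤ) {K : ℤ → ℤ → ℤ → V}
    (hK : ∀ u, Truncated fun s t => K s t u) :
    (∀ u, Truncated fun s t => (mulZX V ^ m) K s t u) ∧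
      (mulZX V ^ m) (binomMul n K) = binomMul n ((mulZX V ^ m) K) := by
  induction m with
  | zero => exact ⟨hK, rfl⟩
  | succ m ih =>
    simp only [pow_succ', Module.End.mul_apply, ih.2]
    refine ⟨fun u => ?_, ?_⟩
    · simpa [mulZX_apply] using ((ih.1 u).shift 1 0).sub (ih.1 (u + 1))
    · funext s t u
      simp only [binomMul, mulZX_apply]
      rw [← binomSum_sub ((ih.1 u).shift _ _) ((ih.1 (u + 1)).shift _ _)]
      simp only [add_assoc]

theorem mulWX_pow_binomMul (m : ℕ) (n : ℤ) {K : ℤ → ℤ → ℤ → V}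
    (hK : ∀ u, Truncated fun s t => K s t u) :
    (∀ u, Truncated fun s t => (mulWX V ^ m) K s t u) ∧
      (mulWX V ^ m) (binomMul n K) = binomMul n ((mulWX V ^ m) K) := by
  induction m with
  | zero => exact ⟨hK, rfl⟩
  | succ m ih =>
    simp only [pow_succ', Module.End.mul_apply, ih.2]
    refine ⟨fun u => ?_, ?_⟩
    · simpa [mulWX_apply] using ((ih.1 u).shift 0 1).sub (ih.1 (u + 1))
    · funext s t u
      simp only [binomMul, mulWX_apply]
      rw [← binomSum_sub ((ih.1 u).shift _ _) ((ih.1 (u + 1)).shift _ _)]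
      simp only [add_assoc]

variable [Module ℂ V]

theorem mulZX_pow_eq (m : ℕ) (F : Dist₂ (Module.End ℂ V)) (f : ℤ → V →+ V) (v : ℤ → V) :
    (mulZX V ^ m) (fun s t u => f t (F (-s - 1) (-u - 1) (v t)))
      = fun s t u => f t (mulSub^[m] F (-s - 1) (-u - 1) (v t)) := by
  induction m with
  | zero => rfl
  | succ m ih =>
    rw [pow_succ', Module.End.mul_apply, ih, Function.iterate_succ_apply']
    funext s t u
    rw [mulZX_apply, mulSub, LinearMap.sub_apply, map_sub,
      show -(s + 1) - 1 = -s - 1 - 1 by ring, show -(u + 1) - 1 = -u - 1 - 1 by ring]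

/-- The variable `z` is a spectator, so `f`, `v` and the offset `d` may depend on `s`. The offset
accommodates the delta terms, whose mode index `s + t - l` mixes both variables. -/
theorem mulWX_pow_eq (m : ℕ) (F : Dist₂ (Module.End ℂ V)) (f : ℤ → V →+ V) (v : ℤ → V)
    (d : ℤ → ℤ) :
    (mulWX V ^ m) (fun s t u => f s (F (d s - t - 1) (-u - 1) (v s)))
      = fun s t u => f s (mulSub^[m] F (d s - t - 1) (-u - 1) (v s)) := by
  induction m with
  | zero => rfl
  | succ m ih =>
    rw [pow_succ', Module.End.mul_apply, ih, Function.iterate_succ_apply']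
    funext s t u
    rw [mulWX_apply, mulSub, LinearMap.sub_apply, map_sub,
      show d s - (t + 1) - 1 = d s - t - 1 - 1 by ring, show -(u + 1) - 1 = -u - 1 - 1 by ring]

end ThreeVariables

/-! ### The two sides of the mode identity with a fixed sign, and their recursion in `n`. -/

variable {V : Type*} [AddCommGroup V] [Module ℂ V] {𝒱 : ZMod 2 → Submodule ℂ V}

namespace StateField

variable (S : StateField 𝒱)

/-- The operator `a_(n)` as an additive map. -/
def nprodHom (a : V) (n : ℤ) : V →+ V := (VertexOperator.ncoeff (S.Y a) n).toAddMonoidHom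

theorem nprodHom_apply (a : V) (n : ℤ) (v : V) : S.nprodHom a n v = S.nprod a n v := rfl

theorem truncated_nprod_nprod (a b v : V) : Truncated fun p q => S.nprod a p (S.nprod b q v) := by
  obtain ⟨N, hN⟩ := S.nprod_eventually_zero b v
  exact ⟨N, fun q hq p => by beta_reduce; rw [hN q hq, nprod_zero_right]⟩

/-- The coefficient of `z ^ (-s-1) w ^ (-t-1)` in
`Y(a,z) Y(b,w) i_{z,w} (z-w)^n v - ε Y(b,w) Y(a,z) i_{w,z} (z-w)^n v`. -/
def expandedBracket (ε : ℤ) (a b : V) (n s t : ℤ) (v : V) : V :=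
  binomSum n (fun p q => S.nprod a (p + s) (S.nprod b (q + t) v))
    - ((n.negOnePow : ℤ) * ε) • binomSum n fun p q => S.nprod b (p + t) (S.nprod a (q + s) v)

/-- The coefficient of `z ^ (-s-1) w ^ (-t-1)` in
`∑_{j ≥ 0} Y(a_(n+j) b, w) v ∂_w^j δ(z,w) / j!`. -/
def deltaExpansion (a b : V) (n s t : ℤ) (v : V) : V := ∑ᶠ j : ℕ, S.modeTermRight a b v n s t j

theorem modeTermRight_eq_zero {a b : V} {n : ℤ} {J : ℕ}
    (hJ : ∀ q ≥ (J : ℤ), S.nprod a (q + n) b = 0) (v : V) (s t : ℤ) {j : ℕ} (hj : J ≤ j) :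
    S.modeTermRight a b v n s t j = 0 := by
  rw [modeTermRight, add_comm n, hJ j (by exact_mod_cast hj), nprod_zero_left, smul_zero]

theorem deltaExpansion_eq_sum {a b : V} {n : ℤ} {J : ℕ}
    (hJ : ∀ q ≥ (J : ℤ), S.nprod a (q + n) b = 0) (s t : ℤ) (v : V) :
    S.deltaExpansion a b n s t v = ∑ j ∈ Finset.range J, S.modeTermRight a b v n s t j :=
  finsum_eq_sum_range fun _ hj => S.modeTermRight_eq_zero hJ v s t hj

/-- Pascal's rule for `s choose j`: the difference of the two terms with index `j + 1` is the term
of the left side with index `j`. -/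
theorem deltaExpansion_succ (a b : V) (n s t : ℤ) (v : V) :
    S.deltaExpansion a b (n + 1) s t v
      = S.deltaExpansion a b n (s + 1) t v - S.deltaExpansion a b n s (t + 1) v := by
  obtain ⟨J, hJ⟩ := S.exists_nprod_add_eq_zero a b n
  have hJ1 : ∀ q ≥ ((J + 1 : ℕ) : ℤ), S.nprod a (q + n) b = 0 := fun q hq =>
    hJ q (by push_cast at hq; omega)
  have hJ2 : ∀ q ≥ (J : ℤ), S.nprod a (q + (n + 1)) b = 0 := fun q hq => by
    rw [show q + (n + 1) = q + 1 + n by ring, hJ (q + 1) (by omega)]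
  rw [S.deltaExpansion_eq_sum hJ2, S.deltaExpansion_eq_sum hJ1, S.deltaExpansion_eq_sum hJ1,
    ← Finset.sum_sub_distrib, Finset.sum_range_succ']
  simp only [modeTermRight, show s + 1 + t = s + (t + 1) by ring, ← sub_smul]
  simp only [Ring.choose_succ_succ, Ring.choose_zero_right, sub_self, zero_smul, add_zero,
    add_sub_cancel_right]
  refine Finset.sum_congr rfl fun j _ => ?_
  rw [Nat.cast_succ, show n + 1 + (j : ℤ) = n + (j + 1) by ring,
    show s + (t + 1) - ((j : ℤ) + 1) = s + t - j by ring]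

theorem expandedBracket_succ (ε : ℤ) (a b : V) (n s t : ℤ) (v : V) :
    S.expandedBracket ε a b (n + 1) s t v
      = S.expandedBracket ε a b n (s + 1) t v - S.expandedBracket ε a b n s (t + 1) v := by
  unfold expandedBracket
  rw [binomSum_succ ((S.truncated_nprod_nprod a b v).shift s t),
    binomSum_succ ((S.truncated_nprod_nprod b a v).shift t s), Int.negOnePow_succ]
  simp only [show ∀ x y : ℤ, x + 1 + y = x + (y + 1) from fun x y => by ring, Units.val_neg]
  module

/-- For `n ≥ 0` both expansions are the same polynomial `(z - w) ^ n`; this is where locality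
enters. -/
theorem expandedBracket_natCast (ε : ℤ) (a b : V) (n : ℕ) (s t : ℤ) (v : V) :
    S.expandedBracket ε a b n s t v
      = mulSub^[n] (prodZW (S.Y a) (S.Y b) - ε • prodWZ (S.Y b) (S.Y a)) (-s - 1) (-t - 1) v := by
  induction n generalizing s t with
  | zero =>
    simp only [expandedBracket, Nat.cast_zero, binomSum_zero_left, zero_add, Int.negOnePow_zero,
      Units.val_one, one_mul, Function.iterate_zero, id, Pi.sub_apply, Pi.smul_apply,
      LinearMap.sub_apply, LinearMap.smul_apply, prodZW_apply]
    simp only [prodWZ, LinearMap.comp_apply, coeff_eq, sub_neg_eq_add, neg_sub, add_sub_cancel_left]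
  | succ n ih =>
    rw [Nat.cast_succ, expandedBracket_succ, ih, ih, Function.iterate_succ_apply', mulSub,
      LinearMap.sub_apply, show -(s + 1) - 1 = -s - 1 - 1 by ring,
      show -(t + 1) - 1 = -t - 1 - 1 by ring]

/-! ### Reduction to homogeneous vectors. -/

variable [DirectSum.Decomposition 𝒱]

theorem modeIdentity_iff_of_mem {i j : ZMod 2} {a b : V} (ha : a ∈ 𝒱 i) (hb : b ∈ 𝒱 j)
    (c : V) (n s t : ℤ) :
    S.ModeIdentity a b c n s t ↔
      S.deltaExpansion a b n s t c = S.expandedBracket (paritySign i j) a b n s t c := by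
  have h1 := (S.truncated_nprod_nprod a b c).shift s t
  have h2 := (S.truncated_nprod_nprod b a c).shift t s
  have h3 := h2.map fun _ _ => DistribSMul.toAddMonoidHom V ((n.negOnePow : ℤ) * paritySign i j)
  have h4 := map_binomSum (DistribSMul.toAddMonoidHom V ((n.negOnePow : ℤ) * paritySign i j)) h2 n
  simp only [DistribSMul.toAddMonoidHom_apply] at h3 h4
  rw [ModeIdentity, expandedBracket, h4, ← binomSum_sub h1 h3, binomSum, deltaExpansion]
  refine Eq.congr rfl (finsum_congr fun k => ?_)
  rw [modeTermLeft, signed_of_mem 𝒱 _ (by simp) (by simp) ha hb, Units.smul_def, smul_smul,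
    sub_add_eq_add_sub, sub_add_eq_add_sub]

theorem signed_add_left {M : Type*} [AddCommGroup M] (B : V → V → M)
    (hB : ∀ a a' b, B (a + a') b = B a b + B a' b) (a a' b : V) :
    signed 𝒱 B (a + a') b = signed 𝒱 B a b + signed 𝒱 B a' b := by
  simp only [signed, DirectSum.decompose_add, DirectSum.add_apply, Submodule.coe_add, hB, smul_add,
    Finset.sum_add_distrib]

theorem signed_add_right {M : Type*} [AddCommGroup M] (B : V → V → M)
    (hB : ∀ a b b', B a (b + b') = B a b + B a b') (a b b' : V) :
    signed 𝒱 B a (b + b') = signed 𝒱 B a b + signed 𝒱 B a b' := by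
  simp only [signed, DirectSum.decompose_add, DirectSum.add_apply, Submodule.coe_add, hB, smul_add,
    Finset.sum_add_distrib]

theorem modeTermLeft_add_left (a a' b c : V) (n s t : ℤ) (j : ℕ) :
    S.modeTermLeft (a + a') b c n s t j
      = S.modeTermLeft a b c n s t j + S.modeTermLeft a' b c n s t j := by
  simp only [modeTermLeft]
  rw [signed_add_left _ (by simp [nprod]), nprod_add_left, ← smul_add, smul_add (n.negOnePow)]
  congr 1
  abel

theorem modeTermLeft_add_right (a b b' c : V) (n s t : ℤ) (j : ℕ) :
    S.modeTermLeft a (b + b') c n s t j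
      = S.modeTermLeft a b c n s t j + S.modeTermLeft a b' c n s t j := by
  simp only [modeTermLeft]
  rw [signed_add_right _ (by simp [nprod]), nprod_add_left, nprod_add_right, ← smul_add,
    smul_add (n.negOnePow)]
  congr 1
  abel

theorem signed_add {M : Type*} [AddCommGroup M] (B B' : V → V → M) (a b : V) :
    signed 𝒱 (fun a b => B a b + B' a b) a b = signed 𝒱 B a b + signed 𝒱 B' a b := by
  simp only [signed, smul_add, Finset.sum_add_distrib]

theorem modeTermLeft_add_vector (a b c c' : V) (n s t : ℤ) (j : ℕ) :
    S.modeTermLeft a b (c + c') n s t j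
      = S.modeTermLeft a b c n s t j + S.modeTermLeft a b c' n s t j := by
  simp only [modeTermLeft, nprod_add_right, signed_add, ← smul_add]
  congr 1
  rw [smul_add (n.negOnePow)]
  abel

/-- The mode identity is additive in each of its three vectors, so it need only be checked on
homogeneous ones. -/
theorem modeIdentity_of_homogeneous (n s t : ℤ)
    (h : ∀ (i j k : ZMod 2) (a b c : V), a ∈ 𝒱 i → b ∈ 𝒱 j → c ∈ 𝒱 k →
      S.ModeIdentity a b c n s t) (a b c : V) : S.ModeIdentity a b c n s t := by
  have zero : ∀ a b c : V, a = 0 ∨ b = 0 ∨ c = 0 → S.ModeIdentity a b c n s t := by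
    rintro a b c (rfl | rfl | rfl) <;>
      simp [ModeIdentity, modeTermLeft, modeTermRight, signed]
  have add : ∀ a b c a' b' c' a'' b'' c'' : V,
      (∀ j, S.modeTermLeft a'' b'' c'' n s t j
        = S.modeTermLeft a b c n s t j + S.modeTermLeft a' b' c' n s t j) →
      (∀ j, S.modeTermRight a'' b'' c'' n s t j
        = S.modeTermRight a b c n s t j + S.modeTermRight a' b' c' n s t j) →
      S.ModeIdentity a b c n s t → S.ModeIdentity a' b' c' n s t →
      S.ModeIdentity a'' b'' c'' n s t := by
    intro a b c a' b' c' a'' b'' c'' hl hr h h'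
    unfold ModeIdentity at *
    rw [finsum_congr hl, finsum_congr hr,
      finsum_add_distrib (S.modeWellDefined a b c n s t).1 (S.modeWellDefined a' b' c' n s t).1,
      finsum_add_distrib (S.modeWellDefined a b c n s t).2 (S.modeWellDefined a' b' c' n s t).2,
      h, h']
  refine DirectSum.Decomposition.inductionOn 𝒱 (zero 0 b c (.inl rfl)) (fun {i} a => ?_)
    (fun a a' => add _ _ _ _ _ _ _ _ _ (S.modeTermLeft_add_left a a' b c n s t)
      fun j => by simp only [modeTermRight, nprod_add_left, smul_add]) a
  refine DirectSum.Decomposition.inductionOn 𝒱 (zero a 0 c (.inr (.inl rfl))) (fun {j} b => ?_)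
    (fun b b' => add _ _ _ _ _ _ _ _ _ (S.modeTermLeft_add_right a b b' c n s t)
      fun j => by simp only [modeTermRight, nprod_add_right, nprod_add_left, smul_add]) b
  exact DirectSum.Decomposition.inductionOn 𝒱 (zero a b 0 (.inr (.inr rfl)))
    (fun {k} c => h i j k a b c a.2 b.2 c.2)
    (fun c c' => add _ _ _ _ _ _ _ _ _ (S.modeTermLeft_add_vector a b c c' n s t)
      fun j => by simp only [modeTermRight, nprod_add_right, smul_add]) c

end StateField

theorem paritySign_add_left (i j k : ZMod 2) :
    paritySign (i + j) k = paritySign i k * paritySign j k := by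
  revert i j k
  decide

/-! ### The Borcherds identity in a vertex algebra. -/

namespace VertexAlgebra

variable [DirectSum.Decomposition 𝒱] (A : VertexAlgebra 𝒱)

theorem nprod_vac_of_nonneg (a : V) {n : ℤ} (hn : 0 ≤ n) : A.nprod a n A.vac = 0 := by
  have h := A.Y_apply_vac a (-n - 1) (by omega)
  rwa [A.coeff_eq, if_neg (by omega), show -(-n - 1) - 1 = n by ring] at h

theorem nprod_neg_one_vac (a : V) : A.nprod a (-1) A.vac = a := by
  have h := A.Y_apply_vac a 0 le_rfl
  rwa [A.coeff_eq, if_pos rfl] at h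

theorem T_nprod (a v : V) (n : ℤ) :
    A.T (A.nprod a n v) = A.nprod a n (A.T v) - n • A.nprod a (n - 1) v := by
  have h := LinearMap.congr_fun (congrFun (A.translation a) (-n - 1)) v
  simp only [LinearMap.sub_apply, LinearMap.comp_apply, A.coeff_eq, deriv₁,
    LinearMap.smul_apply] at h
  rw [show -(-n - 1) - 1 = n by ring, show -(-n - 1 + 1) - 1 = n - 1 by ring,
    show -n - 1 + 1 = -n by ring, neg_smul] at h
  rw [sub_eq_iff_eq_add.mp h]
  abel

theorem T_nprod_vac (a : V) (n : ℤ) :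
    A.T (A.nprod a n A.vac) = -(n • A.nprod a (n - 1) A.vac) := by
  rw [T_nprod, A.T_vac, A.nprod_zero_right, zero_sub]

/-- `Y(a_(n) b, w)|0⟩ = Res_z Y(a,z) Y(b,w) i_{z,w} (z-w)^n |0⟩`. -/
theorem nprod_nprod_vac (a b : V) (n t : ℤ) :
    A.nprod (A.nprod a n b) t A.vac
      = binomSum n fun p q => A.nprod a p (A.nprod b (q + t) A.vac) := by
  rcases le_or_gt 0 t with ht | ht
  · rw [A.nprod_vac_of_nonneg _ ht, binomSum]
    refine (finsum_eq_zero_of_forall_eq_zero fun j => ?_).symm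
    rw [A.nprod_vac_of_nonneg b (by omega), A.nprod_zero_right, smul_zero]
  · refine Int.leInductionDown (m := -1)
      (motive := fun t _ => A.nprod (A.nprod a n b) t A.vac
        = binomSum n fun p q => A.nprod a p (A.nprod b (q + t) A.vac)) ?_ ?_ t (by omega)
    · rw [nprod_neg_one_vac, binomSum, finsum_eq_single _ 0]
      · simp [nprod_neg_one_vac]
      · intro j hj
        rw [A.nprod_vac_of_nonneg b (by omega), A.nprod_zero_right, smul_zero]
    · intro t ht ih
      have htr : Truncated fun p q => A.nprod a p (A.nprod b (q + (t - 1)) A.vac) := by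
        simpa using (A.truncated_nprod_nprod a b A.vac).shift 0 (t - 1)
      have h := binomSum_derivation A.T.toAddMonoidHom htr n t fun p q => by
        simp only [LinearMap.toAddMonoidHom_coe]
        rw [T_nprod, T_nprod_vac, show q + 1 + (t - 1) = q + t by ring, ← neg_smul,
          A.nprod_zsmul_right, show q + t - 1 = q + (t - 1) by ring]
        module
      simp only [show ∀ q : ℤ, q + 1 + (t - 1) = q + t from fun q => by ring,
        LinearMap.toAddMonoidHom_coe, ← ih, T_nprod_vac, ← neg_smul] at h
      -- Applying `T` to the case `t` gives the case `t - 1` multiplied by `-t`, which is invertible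
      -- in `ℂ` because `t ≤ -1`.
      rw [← Int.cast_smul_eq_zsmul ℂ, ← Int.cast_smul_eq_zsmul ℂ] at h
      exact smul_right_injective V
        (Int.cast_ne_zero.mpr (show -t ≠ 0 by omega)) h

theorem isLocal_of_mem {i j : ZMod 2} {a b : V} (ha : a ∈ 𝒱 i) (hb : b ∈ 𝒱 j) :
    ∃ N : ℕ, ∀ n ≥ N,
      mulSub^[n] (prodZW (A.Y a) (A.Y b) - paritySign i j • prodWZ (A.Y b) (A.Y a)) = 0 := by
  obtain ⟨N, hN⟩ := A.locality a b
  refine ⟨N, fun n hn => ?_⟩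
  have h := hN n hn
  rwa [StateField.bracket, StateField.signedSwap,
    signed_of_mem 𝒱 _ (by intro b; funext i k; simp [prodWZ])
      (by intro b; funext i k; simp [prodWZ]) ha hb] at h

/-- The Borcherds identity applied to the vacuum. -/
theorem deltaExpansion_vac {i j : ZMod 2} {a b : V} (ha : a ∈ 𝒱 i) (hb : b ∈ 𝒱 j) (n s t : ℤ) :
    A.deltaExpansion a b n s t A.vac
      = A.expandedBracket (paritySign i j) a b n s t A.vac := by
  obtain ⟨N, hN⟩ := A.isLocal_of_mem ha hb
  obtain ⟨J, hJ⟩ := A.exists_nprod_add_eq_zero a b 0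
  -- Both sides are zero here: `N` is the order of locality, and `a_(q) b = 0` from `q = J` on.
  have large : ∀ n ≥ ((N + J : ℕ) : ℤ), ∀ s t, A.deltaExpansion a b n s t A.vac
      = A.expandedBracket (paritySign i j) a b n s t A.vac := by
    intro n hn s t
    obtain ⟨m, rfl⟩ := Int.eq_ofNat_of_zero_le (show 0 ≤ n by omega)
    rw [A.expandedBracket_natCast, hN m (by omega),
      A.deltaExpansion_eq_sum (J := 0) fun q hq => by
        simpa using hJ (q + m) (by push_cast at hn hq; omega)]
    simp
  rcases le_total ((N + J : ℕ) : ℤ) n with hn | hn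
  · exact large n hn s t
  revert s t
  refine Int.leInductionDown (m := ((N + J : ℕ) : ℤ))
    (motive := fun n _ => ∀ s t, A.deltaExpansion a b n s t A.vac
      = A.expandedBracket (paritySign i j) a b n s t A.vac) (large _ le_rfl) ?_ n hn
  intro n _ ih
  -- The discrepancy at `n - 1` is killed by `z - w`, so it depends only on `s + t`; it suffices to
  -- treat `s = 0`.
  have step : ∀ s t, A.deltaExpansion a b (n - 1) (s + 1) t A.vac
        - A.deltaExpansion a b (n - 1) s (t + 1) A.vac
      = A.expandedBracket (paritySign i j) a b (n - 1) (s + 1) t A.vac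
        - A.expandedBracket (paritySign i j) a b (n - 1) s (t + 1) A.vac := fun s t => by
    rw [← A.deltaExpansion_succ, ← A.expandedBracket_succ, sub_add_cancel, ih]
  intro s
  induction s using Int.induction_on with
  | zero =>
    intro t
    rw [StateField.deltaExpansion, finsum_eq_single _ 0, StateField.modeTermRight,
      StateField.expandedBracket]
    -- At `s = 0` only nonnegative modes of `a` reach the vacuum in the swapped product, and they
    -- kill it.
    · have h0 : (binomSum (n - 1) fun p q =>
          A.nprod b (p + t) (A.nprod a (q + 0) A.vac)) = 0 :=
        finsum_eq_zero_of_forall_eq_zero fun k => by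
          beta_reduce
          rw [A.nprod_vac_of_nonneg a (by omega), A.nprod_zero_right, smul_zero]
      rw [h0, smul_zero, sub_zero]
      simpa using A.nprod_nprod_vac a b (n - 1) t
    · intro k hk
      rw [StateField.modeTermRight, Ring.choose_zero_pos ℤ (Nat.pos_of_ne_zero hk), zero_smul]
  | succ s ih' =>
    intro t
    have h := step s t
    rwa [ih' (t + 1), sub_left_inj] at h
  | pred s ih' =>
    intro t
    have h := step (-s - 1) (t - 1)
    rwa [sub_add_cancel, sub_add_cancel, ih' (t - 1), sub_right_inj] at h

/-- The coefficients of
`(Y(a,z) Y(b,w) Y(c,x) - η Y(c,x) Y(a,z) Y(b,w)) |0⟩`. -/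
def tripleBracket (η : ℤ) (a b c : V) (s t u : ℤ) : V :=
  A.nprod a s (A.nprod b t (A.nprod c u A.vac)) - η • A.nprod c u (A.nprod a s (A.nprod b t A.vac))

theorem bracket_apply (η : ℤ) (a b : V) (i k : ℤ) (v : V) :
    (prodZW (A.Y a) (A.Y b) - η • prodWZ (A.Y b) (A.Y a)) i k v
      = A.nprod a (-i - 1) (A.nprod b (-k - 1) v)
        - η • A.nprod b (-k - 1) (A.nprod a (-i - 1) v) := by
  simp only [Pi.sub_apply, Pi.smul_apply, LinearMap.sub_apply, LinearMap.smul_apply,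
    A.prodZW_apply]
  simp only [prodWZ, LinearMap.comp_apply, A.coeff_eq]

theorem truncated_tripleBracket (η : ℤ) (a b c : V) (u : ℤ) :
    Truncated fun s t => A.tripleBracket η a b c s t u :=
  (A.truncated_nprod_nprod a b _).sub <| (A.truncated_nprod_nprod a b A.vac).map
    fun _ _ => (DistribSMul.toAddMonoidHom V η).comp (A.nprodHom c u)

/-- The Leibniz rule `[ab, c] = a[b, c] + p(b,c) [a, c]b` for supercommutators: a power of `w - x`
kills the first term and a power of `z - x` the second. -/
theorem tripleBracket_local {i j k : ZMod 2} {a b c : V} (ha : a ∈ 𝒱 i) (hb : b ∈ 𝒱 j)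
    (hc : c ∈ 𝒱 k) : ∃ M : ℕ, ∀ m ≥ M,
      (mulZX V ^ m) ((mulWX V ^ m)
        (A.tripleBracket (paritySign i k * paritySign j k) a b c)) = 0 := by
  obtain ⟨M, hM⟩ := A.isLocal_of_mem ha hc
  obtain ⟨N, hN⟩ := A.isLocal_of_mem hb hc
  refine ⟨M + N, fun m hm => ?_⟩
  have key : A.tripleBracket (paritySign i k * paritySign j k) a b c
      = (fun s t u => A.nprodHom a s
          ((prodZW (A.Y b) (A.Y c) - paritySign j k • prodWZ (A.Y c) (A.Y b))
            (0 - t - 1) (-u - 1) A.vac))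
        + fun s t u => DistribSMul.toAddMonoidHom V (paritySign j k)
          ((prodZW (A.Y a) (A.Y c) - paritySign i k • prodWZ (A.Y c) (A.Y a))
            (-s - 1) (-u - 1) (A.nprod b t A.vac)) := by
    funext s t u
    simp only [Pi.add_apply, bracket_apply, tripleBracket, A.nprodHom_apply,
      DistribSMul.toAddMonoidHom_apply, A.nprod_sub_right, A.nprod_zsmul_right]
    simp only [show ∀ x : ℤ, -(-x - 1) - 1 = x from fun x => by ring,
      show ∀ x : ℤ, -(0 - x - 1) - 1 = x from fun x => by ring]
    module
  have h1 := mulWX_pow_eq m (prodZW (A.Y b) (A.Y c) - paritySign j k • prodWZ (A.Y c) (A.Y b))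
    (A.nprodHom a) (fun _ => A.vac) (fun _ => 0)
  have h2 := mulZX_pow_eq m (prodZW (A.Y a) (A.Y c) - paritySign i k • prodWZ (A.Y c) (A.Y a))
    (fun _ => DistribSMul.toAddMonoidHom V (paritySign j k)) fun t => A.nprod b t A.vac
  rw [hN m (by omega)] at h1
  rw [hM m (by omega)] at h2
  simp only [Pi.zero_apply, LinearMap.zero_apply, map_zero] at h1 h2
  change _ = (0 : ℤ → ℤ → ℤ → V) at h1 h2
  rw [key, map_add, map_add, h1, map_zero, zero_add, ← Module.End.mul_apply,
    (commute_mulZX_mulWX.pow_pow m m).eq, Module.End.mul_apply, h2, map_zero]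

theorem nprod_expandedBracket (ε η : ℤ) (a b c : V) (n s t u : ℤ) :
    A.expandedBracket ε a b n s t (A.nprod c u A.vac)
        - η • A.nprod c u (A.expandedBracket ε a b n s t A.vac)
      = binomMul n (A.tripleBracket η a b c) s t u
        - ((n.negOnePow : ℤ) * ε) • swapZW (binomMul n (A.tripleBracket η b a c)) s t u := by
  have h : ∀ (a b : V) (s t : ℤ), binomMul n (A.tripleBracket η a b c) s t u
      = binomSum n (fun p q => A.nprod a (p + s) (A.nprod b (q + t) (A.nprod c u A.vac)))
        - η • A.nprod c u
          (binomSum n fun p q => A.nprod a (p + s) (A.nprod b (q + t) A.vac)) := by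
    intro a b s t
    have h1 := (A.truncated_nprod_nprod a b (A.nprod c u A.vac)).shift s t
    have h2 := (A.truncated_nprod_nprod a b A.vac).shift s t
    have h3 := map_binomSum ((DistribSMul.toAddMonoidHom V η).comp (A.nprodHom c u)) h2 n
    have h4 := h2.map fun _ _ => (DistribSMul.toAddMonoidHom V η).comp (A.nprodHom c u)
    exact (binomSum_sub h1 h4 n).trans (congrArg _ h3.symm)
  rw [swapZW, h, h, StateField.expandedBracket, StateField.expandedBracket, A.nprod_sub_right,
    A.nprod_zsmul_right]
  module

/-- The vector `a_(n+l) b` has parity `i + j`, so its locality with `c` carries the sign `paritySign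
i k * paritySign j k` by bimultiplicativity, matching that of the triple products. -/
theorem deltaTerm_local {i j k : ZMod 2} {a b c : V} (ha : a ∈ 𝒱 i) (hb : b ∈ 𝒱 j)
    (hc : c ∈ 𝒱 k) (n : ℤ) (l : ℕ) : ∃ N : ℕ, ∀ m ≥ N,
      (mulWX V ^ m) (fun s t u => A.modeTermRight a b (A.nprod c u A.vac) n s t l
        - (paritySign i k * paritySign j k) •
          A.nprod c u (A.modeTermRight a b A.vac n s t l)) = 0 := by
  have hd : A.nprod a (n + l) b ∈ 𝒱 (i + j) := A.parity i j a b ha hb _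
  obtain ⟨N, hN⟩ := A.isLocal_of_mem hd hc
  refine ⟨N, fun m hm => ?_⟩
  have h := mulWX_pow_eq m (prodZW (A.Y (A.nprod a (n + l) b)) (A.Y c)
    - paritySign (i + j) k • prodWZ (A.Y c) (A.Y (A.nprod a (n + l) b)))
    (fun s => DistribSMul.toAddMonoidHom V (Ring.choose s l)) (fun _ => A.vac) (fun s => l - s)
  rw [hN m hm] at h
  simp only [Pi.zero_apply, LinearMap.zero_apply, map_zero, bracket_apply,
    DistribSMul.toAddMonoidHom_apply, paritySign_add_left] at h
  refine Eq.trans (congrArg _ ?_) h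
  funext s t u
  simp only [StateField.modeTermRight, A.nprod_zsmul_right,
    show -(-u - 1) - 1 = u by ring, show -((l : ℤ) - s - t - 1) - 1 = s + t - l by ring]
  module

/-- The Borcherds identity in modes, for homogeneous vectors. -/
theorem deltaExpansion_eq_expandedBracket {i j k : ZMod 2} {a b c : V} (ha : a ∈ 𝒱 i)
    (hb : b ∈ 𝒱 j) (hc : c ∈ 𝒱 k) (n s t : ℤ) :
    A.deltaExpansion a b n s t c = A.expandedBracket (paritySign i j) a b n s t c := by
  set η := paritySign i k * paritySign j k with hη
  set H : ℤ → ℤ → ℤ → V := fun s t u => A.deltaExpansion a b n s t (A.nprod c u A.vac)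
    - A.expandedBracket (paritySign i j) a b n s t (A.nprod c u A.vac) with hHdef
  -- The mode `u` is the coefficient of `x ^ (-u-1)`, so this excludes negative powers of `x`.
  have hH : ∀ s t, ∀ u ≥ 0, H s t u = 0 := fun s t u hu => by
    simp [hHdef, A.nprod_vac_of_nonneg c hu, StateField.deltaExpansion, StateField.modeTermRight,
      StateField.expandedBracket, binomSum]
  obtain ⟨J, hJ⟩ := A.exists_nprod_add_eq_zero a b n
  obtain ⟨M₁, h₁⟩ := A.tripleBracket_local ha hb hc
  obtain ⟨M₂, h₂⟩ := A.tripleBracket_local hb ha hc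
  choose N hN using A.deltaTerm_local ha hb hc n
  set m := M₁ + M₂ + ∑ l ∈ Finset.range J, N l with hm
  -- As `D(z,w)|0⟩ = 0`, subtracting `η Y(c,x) D(z,w)|0⟩` changes nothing and turns `H` into a
  -- supercommutator.
  have key : H = ∑ l ∈ Finset.range J, (fun s t u =>
        A.modeTermRight a b (A.nprod c u A.vac) n s t l
          - η • A.nprod c u (A.modeTermRight a b A.vac n s t l))
      - (binomMul n (A.tripleBracket η a b c)
        - ((n.negOnePow : ℤ) * paritySign i j) •
          swapZW (binomMul n (A.tripleBracket η b a c))) := by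
    funext s t u
    have h := A.nprod_expandedBracket (paritySign i j) η a b c n s t u
    rw [← A.deltaExpansion_vac ha hb, A.deltaExpansion_eq_sum hJ, A.nprod_sum_right] at h
    simp only [Pi.sub_apply, Pi.smul_apply, Finset.sum_apply]
    rw [← h, hHdef, Finset.sum_sub_distrib, Finset.smul_sum]
    beta_reduce
    rw [A.deltaExpansion_eq_sum hJ]
    abel
  have t₁ := A.truncated_tripleBracket η a b c
  have t₂ := A.truncated_tripleBracket η b a c
  have e₁ : (mulZX V ^ m) ((mulWX V ^ m) (binomMul n (A.tripleBracket η a b c))) = 0 := by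
    have h := mulWX_pow_binomMul m n t₁
    rw [h.2, (mulZX_pow_binomMul m n h.1).2, h₁ m (by omega)]
    funext s t u
    simp [binomMul, binomSum]
  have e₂ : (mulZX V ^ m) ((mulWX V ^ m) (swapZW (binomMul n (A.tripleBracket η b a c)))) = 0 := by
    have h := mulZX_pow_binomMul m n t₂
    rw [mulWX_pow_swapZW, mulZX_pow_swapZW, h.2, (mulWX_pow_binomMul m n h.1).2,
      ← Module.End.mul_apply, ← (commute_mulZX_mulWX.pow_pow m m).eq, Module.End.mul_apply,
      hη, mul_comm, h₂ m (by omega)]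
    funext s t u
    simp [binomMul, binomSum, swapZW]
  have e : (mulZX V ^ m) ((mulWX V ^ m) H) = 0 := by
    rw [key]
    simp only [map_sub, map_sum, map_zsmul, e₁, e₂, smul_zero, sub_zero]
    refine Finset.sum_eq_zero fun l hl => ?_
    have : N l ≤ ∑ l ∈ Finset.range J, N l :=
      Finset.single_le_sum (fun _ _ => Nat.zero_le _) hl
    rw [hN l m (by omega), map_zero]
  -- The factors are stripped one at a time. The remaining mode `u = -1` is evaluated at `c_(-1)|0⟩
  -- = c`.
  have h := apply_neg_one_eq_zero_of_mulWX_pow hH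
    (apply_neg_one_eq_zero_of_mulZX_pow (mulWX_pow_nonneg m hH) fun s t => by rw [e]; rfl) s t
  simpa [hHdef, A.nprod_neg_one_vac, sub_eq_zero] using h

theorem modeIdentity (a b c : V) (n s t : ℤ) : A.ModeIdentity a b c n s t :=
  A.modeIdentity_of_homogeneous n s t (fun _ _ _ _ _ _ ha hb hc =>
    (A.modeIdentity_iff_of_mem ha hb _ n s t).mpr
      (A.deltaExpansion_eq_expandedBracket ha hb hc n s t)) a b c

end VertexAlgebra

end FormalVertex

end

/-- First part: all sums that occur are finite. Second part: the Borcherds identity of formal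
distributions holds in every vertex algebra. Third part: that identity is equivalent to its
translation in modes, for any state-field correspondence. Fourth part: the mode identity holds in
every vertex algebra. -/
theorem mainTheorem3 {V : Type*} [AddCommGroup V] [Module ℂ V] (𝒱 : ZMod 2 → Submodule ℂ V)
    [DirectSum.Decomposition 𝒱] :
    (∀ (S : FormalVertex.StateField 𝒱) (a b : V) (n : ℤ),
      S.DistWellDefined a b n ∧ ∀ (c : V) (s t : ℤ), S.ModeWellDefined a b c n s t) ∧
    (∀ (A : FormalVertex.VertexAlgebra 𝒱) (a b : V) (n : ℤ), A.DistIdentity a b n) ∧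
    (∀ (S : FormalVertex.StateField 𝒱) (a b : V) (n : ℤ),
      S.DistIdentity a b n ↔ ∀ (c : V) (s t : ℤ), S.ModeIdentity a b c n s t) ∧
    (∀ (A : FormalVertex.VertexAlgebra 𝒱) (a b c : V) (n s t : ℤ),
      A.ModeIdentity a b c n s t) :=
  ⟨fun S a b n => ⟨S.distWellDefined a b n, fun c s t => S.modeWellDefined a b c n s t⟩,
    fun A a b n => (A.distIdentity_iff a b n).mpr fun c s t => A.modeIdentity a b c n s t,
    fun S a b n => S.distIdentity_iff a b n, fun A a b c n s t => A.modeIdentity a b c n s t⟩
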